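/- Conventions. A pro-$C^*$-algebra is a complete Hausdorff topological $*$-algebra over $\mathbb{C}$ whose topology is defined by its continuous $C^*$-seminorms (submultiplicative seminorms $p$ with $p(a^*a)=p(a)^2$). A complex topological vector space is barreled if each of its barrels (absolutely convex, absorbing, closed subsets) is a neighborhood of the origin. A subset $S$ of a topological space $X$ is relatively pseudocompact if every continuous function $X\to\mathbb{R}$ is bounded on $S$, and relatively compact if its closure in $X$ is compact. Tychonoff means $T_{3\frac12}$. A space $X$ is functionally Hausdorff if any two distinct points are separated by a continuous function $X\to\mathbb{R}$, and a $\kappa$-space (compactly generated) if a subset is closed whenever its intersection with every compact $K\subseteq X$ is closed in $K$. The Tychonoff reflection $X\to\tau X$ is the universal continuous map from $X$ to a Tychonoff space. **Theorem.** (1) A unital commutative pro-$C^*$-algebra $A$ is barreled if and only if it is isomorphic, as a topological unital $*$-algebra, to $C(X)$ (the continuous functions $X\to\mathbb{C}$) with the compact-open topology, for some Tychonoff space $X$ all of whose relatively pseudocompact subsets are relatively compact. (2) Let $X$ be a functionally Hausdorff $\kappa$-space all of whose relatively pseudocompact subsets are relatively compact. Then the canonical map $\eta\colon X\to\tau X$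 is bijective, and, $X$ and $\tau X$ being identified as sets through $\eta$, the compact subspaces of $\tau X$ are precisely the compact subspaces of $X$: a subset $K\subseteq X$ is compact if and only if $\eta(K)\subseteq\tau X$ is compact, and in that case $\eta$ restricts to a homeomorphism $K\cong\eta(K)$. -/

import Mathlib

open Topology

/-! ### Pro-C⋆-algebras -/

/-- A C⋆-seminorm on a complex ⋆-algebra: a submultiplicative seminorm with `p (a⋆ a) = p(a)²`. -/
structure IsCStarSeminorm {A : Type*} [Ring A] [Algebra ℂ A] [StarRing A]
    (p : Seminorm ℂ A) : Prop where
  mul_le : ∀ a b : A, p (a * b) ≤ p a * p b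
  star_mul_self : ∀ a : A, p (star a * a) = p a ^ 2

/-- The set `S(A)` of continuous C⋆-seminorms on a topological ⋆-algebra. -/
def ContCStarSeminorm (A : Type*) [Ring A] [Algebra ℂ A] [StarRing A] [TopologicalSpace A] :
    Type _ :=
  {p : Seminorm ℂ A // IsCStarSeminorm p ∧ Continuous p}

/-- A (unital) pro-C⋆-algebra: a complete Hausdorff topological ⋆-algebra over `ℂ` whose topology
is the one defined by its continuous C⋆-seminorms. The uniform structure is the one that the
additive group carries because of `IsUniformAddGroup`. -/
class IsProCStarAlgebra (A : Type*) [Ring A] [Algebra ℂ A] [StarRing A]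
    [UniformSpace A] : Prop extends StarModule ℂ A, IsUniformAddGroup A, IsTopologicalRing A,
    ContinuousSMul ℂ A, ContinuousStar A, CompleteSpace A, T2Space A where
  withSeminorms : WithSeminorms (fun p : ContCStarSeminorm A => p.1)

/-! ### Barrels -/

/-- A barrel: an absolutely convex (balanced and convex), absorbing and closed set. -/
structure IsBarrel {E : Type*} [AddCommGroup E] [Module ℂ E] [TopologicalSpace E]
    (B : Set E) : Prop where
  balanced : Balanced ℂ B
  convex : Convex ℝ B
  absorbent : Absorbent ℂ B
  isClosed : IsClosed B

/-- A complex topological vector space is barreled if each barrel is a neighborhood of the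
origin. -/
def IsBarreled (E : Type*) [AddCommGroup E] [Module ℂ E] [TopologicalSpace E] : Prop :=
  ∀ B : Set E, IsBarrel B → B ∈ 𝓝 (0 : E)

/-- Being barreled agrees with Mathlib's `BarrelledSpace`, which is phrased through lower
semicontinuous seminorms. -/
theorem isBarreled_iff_barrelledSpace {E : Type*} [AddCommGroup E] [Module ℂ E]
    [TopologicalSpace E] [IsTopologicalAddGroup E] [ContinuousSMul ℂ E] :
    IsBarreled E ↔ BarrelledSpace ℂ E := by
  constructor
  · intro h
    refine ⟨fun p hp => ?_⟩
    have hB : IsBarrel (p.closedBall 0 1) :=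
      { balanced := p.balanced_closedBall_zero 1
        convex := p.convex_closedBall 0 1
        absorbent := p.absorbent_closedBall_zero one_pos
        isClosed := by
          rw [p.closedBall_zero_eq]
          exact hp.isClosed_preimage 1 }
    exact Seminorm.continuous' (r := 1) (h _ hB)
  · intro h B hB
    have hR : Absorbent ℝ B := by
      intro x
      obtain ⟨r, hr⟩ := absorbs_iff_norm.1 (hB.absorbent x)
      refine absorbs_iff_norm.2 ⟨r, fun c hc y hy => ?_⟩
      obtain ⟨z, hz, hzy⟩ := hr (c : ℂ) (by simpa using hc) hy
      exact ⟨z, hz, by rw [← hzy]; exact (Complex.coe_smul c z).symm⟩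
    have : ContinuousSMul ℝ E := IsScalarTower.continuousSMul ℂ
    let p : Seminorm ℂ E := gaugeSeminorm hB.balanced hB.convex hR
    have hp : ∀ x, p x = gauge B x := fun _ => rfl
    have h0 : (0 : E) ∈ B := hB.absorbent.zero_mem
    have hlsc : LowerSemicontinuous p := by
      rw [lowerSemicontinuous_iff_isClosed_preimage]
      intro y
      rcases lt_or_ge y 0 with hy | hy
      · convert isClosed_empty
        ext x
        simpa using lt_of_lt_of_le hy (apply_nonneg p x)
      · have : p ⁻¹' Set.Iic y = {x | gauge B x ≤ y} := rfl
        rw [this, setOfPred_gauge_le_eq hB.convex h0 hR hy]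
        refine isClosed_iInter fun r => isClosed_iInter fun hr => ?_
        have hr0 : r ≠ 0 := (lt_of_le_of_lt hy hr).ne'
        exact hB.isClosed.smul_of_ne_zero hr0
    have hc : Continuous p := p.continuous_of_lowerSemicontinuous hlsc
    have hU : {x | p x < 1} ∈ 𝓝 (0 : E) :=
      (isOpen_lt hc continuous_const).mem_nhds (by simp)
    exact Filter.mem_of_superset hU
      (setOfPred_gauge_lt_one_subset_self hB.convex h0 hR)

/-! ### Topological notions -/

/-- Functionally Hausdorff: distinct points are separated by a continuous real-valued function. -/
class FunctionallyHausdorffSpace (X : Type*) [TopologicalSpace X] : Prop where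
  exists_ne : ∀ x y : X, x ≠ y → ∃ f : C(X, ℝ), f x ≠ f y

/-- `A` is relatively pseudocompact in `X`: each continuous real-valued function on `X` is bounded
on `A`. -/
def IsRelPseudocompact {X : Type*} [TopologicalSpace X] (A : Set X) : Prop :=
  ∀ f : C(X, ℝ), Bornology.IsBounded (f '' A)

/-- `A` is relatively compact in `X`: its closure is compact. -/
def IsRelCompact {X : Type*} [TopologicalSpace X] (A : Set X) : Prop :=
  IsCompact (closure A)

/-! ### The Tychonoff reflection -/

/-- The Tychonoff reflection `τX`: the image of `X` under the evaluation map into the product of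
copies of `ℝ` indexed by `C(X, ℝ)`, with the subspace topology. Equivalently, the set of classes of
points of `X` modulo the equality of all the values of continuous real-valued functions, with the
weakest topology that makes these functions continuous. -/
def TychonoffReflection (X : Type*) [TopologicalSpace X] : Type _ :=
  Set.range (fun (x : X) (f : C(X, ℝ)) => f x)

namespace TychonoffReflection

instance (X : Type*) [TopologicalSpace X] : TopologicalSpace (TychonoffReflection X) :=
  inferInstanceAs (TopologicalSpace (Set.range (fun (x : X) (f : C(X, ℝ)) => f x)))

instance (X : Type*) [TopologicalSpace X] : T35Space (TychonoffReflection X) :=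
  inferInstanceAs (T35Space (Set.range (fun (x : X) (f : C(X, ℝ)) => f x)))

/-- The canonical map `X → τX`. -/
def unit (X : Type*) [TopologicalSpace X] : X → TychonoffReflection X :=
  Set.rangeFactorization (fun (x : X) (f : C(X, ℝ)) => f x)

theorem continuous_unit (X : Type*) [TopologicalSpace X] : Continuous (unit X) :=
  Continuous.subtype_mk (continuous_pi fun f => f.continuous) _

theorem surjective_unit (X : Type*) [TopologicalSpace X] : Function.Surjective (unit X) :=
  Set.rangeFactorization_surjective

/-- The universal property: a continuous map from `X` to a Tychonoff space factors uniquely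
through `τX`. -/
theorem existsUnique_lift {X Y : Type*} [TopologicalSpace X] [TopologicalSpace Y] [T35Space Y]
    (g : C(X, Y)) : ∃! h : C(TychonoffReflection X, Y), ∀ x, h (unit X x) = g x := by
  have key : ∀ (f : C(Y, ℝ)) (x x' : X), unit X x = unit X x' → f (g x) = f (g x') := by
    intro f x x' hx
    exact congrFun (congrArg Subtype.val hx) (f.comp g)
  have sep : ∀ y y' : Y, (∀ f : C(Y, ℝ), f y = f y') → y = y' := by
    intro y y' hy
    by_contra hne
    obtain ⟨f, hf, h0, h1⟩ :=
      CompletelyRegularSpace.completely_regular y {y'} isClosed_singleton (by simpa using hne)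
    have := hy ⟨fun z => (f z : ℝ), continuous_subtype_val.comp hf⟩
    have h1' : f y' = 1 := h1 rfl
    simp [h0, h1'] at this
  choose s hs using surjective_unit X
  have hfac : ∀ x, g (s (unit X x)) = g x := fun x =>
    sep _ _ fun f => key f _ _ (hs _)
  have hcont : Continuous fun t : TychonoffReflection X => g (s t) := by
    rw [continuous_iff_continuousAt]
    intro t
    rw [ContinuousAt, Filter.tendsto_def]
    intro V hV
    obtain ⟨U, hUV, hU, htU⟩ := mem_nhds_iff.1 hV
    obtain ⟨f, hf, h0, h1⟩ :=
      CompletelyRegularSpace.completely_regular_isOpen (g (s t)) U hU htU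
    let F : C(Y, ℝ) := ⟨fun z => (f z : ℝ), continuous_subtype_val.comp hf⟩
    let e : TychonoffReflection X → ℝ := fun q => q.1 (F.comp g)
    have he : Continuous e := (continuous_apply (F.comp g)).comp continuous_subtype_val
    have hes : ∀ q, e q = F (g (s q)) := by
      intro q
      conv_lhs => rw [← hs q]
      rfl
    have hO : {q | e q < 1} ∈ 𝓝 t := by
      refine (isOpen_lt he continuous_const).mem_nhds ?_
      have : e t = 0 := by rw [hes]; simp [F, h0]
      simp [this]
    filter_upwards [hO] with q hq
    refine hUV ?_
    by_contra hqU
    have h2 : f (g (s q)) = 1 := h1 hqU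
    have h3 : e q < 1 := hq
    rw [hes] at h3
    simp [F, h2] at h3
  refine ⟨⟨_, hcont⟩, hfac, ?_⟩
  intro h hh
  ext t
  obtain ⟨x, rfl⟩ := surjective_unit X t
  rw [hh]
  exact (hfac x).symm

end TychonoffReflection

universe u v

/-! ### Neighborhoods in the compact-open topology -/

/-! (1) The space is the spectrum: ⋆-characters bounded by some continuous C⋆-seminorm, with the
pointwise topology. The characters bounded by a given `p` form a compact set, on which every nonzero
`p a` is attained. Hence the Gelfand map is injective. Stone–Weierstrass on these compact sets and
completeness of `A` make it surjective, with continuous inverse. Its own continuity asks that each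
compact set of characters be bounded by one `p`. Barreledness gives this for every pointwise bounded
set, since its polar is a barrel (`IsBarreled.exists_subset_spectrumBall`); relatively pseudocompact
sets are thereby also relatively compact. The converse is the Nachbin–Shirota argument
(`ContinuousMap.barrelledSpace`): a lower semicontinuous seminorm on `C(X, ℂ)` has a relatively
pseudocompact, hence compact, support, kills the functions vanishing there, and is dominated by the
sup norm on bounded functions. Truncation bounds it by the supremum over the support. (2) Continuous
functions factor through `τX`, so a set with compact image is relatively pseudocompact. It is also
closed, as the preimage of its image, hence compact. -/

theorem ContinuousMap.hasBasis_nhds_norm_sub {X : Type*} [TopologicalSpace X] (f : C(X, ℂ)) :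
    (𝓝 f).HasBasis (fun q : Set X × ℝ => IsCompact q.1 ∧ 0 < q.2)
      fun q => {g | ∀ x ∈ q.1, ‖g x - f x‖ < q.2} := by
  have h := nhds_basis_uniformity'
    (Metric.uniformity_basis_dist (α := ℂ)).compactConvergenceUniformity (x := f)
  refine h.congr (fun _ => Iff.rfl) fun q _ => ?_
  ext g
  refine forall₂_congr fun x _ => ?_
  change dist (f x) (g x) < q.2 ↔ _
  rw [dist_comm, dist_eq_norm]

theorem ContinuousMap.setOf_norm_lt_mem_nhds_zero {X : Type*} [TopologicalSpace X] {K : Set X}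
    (hK : IsCompact K) {δ : ℝ} (hδ : 0 < δ) :
    {g : C(X, ℂ) | ∀ x ∈ K, ‖g x‖ < δ} ∈ 𝓝 (0 : C(X, ℂ)) := by
  simpa using (ContinuousMap.hasBasis_nhds_norm_sub (0 : C(X, ℂ))).mem_of_mem
    (i := (K, δ)) ⟨hK, hδ⟩

/-! ### Characters bounded by a C⋆-seminorm -/

/-- In a commutative seminormed algebra whose seminorm is compatible with squares, the seminorm of
an element is attained by a character. -/
theorem exists_algHom_norm_apply_eq {R : Type*} [SeminormedCommRing R] [NormedAlgebra ℂ R]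
    (hR : ∀ a : R, ‖a ^ 2‖ = ‖a‖ ^ 2) (a : R) (ha : ‖a‖ ≠ 0) :
    ∃ χ : R →ₐ[ℂ] ℂ, (∀ b, ‖χ b‖ ≤ ‖b‖) ∧ ‖χ a‖ = ‖a‖ := by
  have h1 : ‖(1 : R)‖ = 1 := by
    have h0 : ‖(1 : R)‖ ≠ 0 := by
      intro h
      refine ha (le_antisymm ?_ (norm_nonneg a))
      calc ‖a‖ = ‖a * 1‖ := by rw [mul_one]
        _ ≤ ‖a‖ * ‖(1 : R)‖ := norm_mul_le _ _
        _ = 0 := by rw [h, mul_zero]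
    have := hR 1
    rw [one_pow, sq] at this
    exact (mul_left_cancel₀ h0 (by rw [mul_one]; exact this)).symm
  -- Completing also divides out the null elements, so Banach algebra theory applies.
  let B := UniformSpace.Completion R
  have hB1 : ‖(1 : B)‖ = 1 := by
    rw [← UniformSpace.Completion.coe_one, UniformSpace.Completion.norm_coe, h1]
  have : NormOneClass B := ⟨hB1⟩
  have hnt : Nontrivial B := NormOneClass.nontrivial
  have hpow : ∀ n : ℕ, ‖(a : B) ^ 2 ^ n‖₊ = ‖a‖₊ ^ 2 ^ n := by
    have hR' : ∀ n : ℕ, ‖a ^ 2 ^ n‖ = ‖a‖ ^ 2 ^ n := by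
      intro n
      induction n with
      | zero => simp
      | succ n ih => rw [pow_succ, pow_mul, hR, ih, ← pow_mul]
    intro n
    ext
    have hcoe : (a : B) ^ 2 ^ n = ((a ^ 2 ^ n : R) : B) :=
      (map_pow UniformSpace.Completion.coeRingHom a (2 ^ n)).symm
    rw [hcoe, coe_nnnorm, UniformSpace.Completion.norm_coe, hR']
    simp
  -- Gelfand's formula along the exponents `2 ^ n`, where the roots are constant.
  have hrad : spectralRadius ℂ (a : B) = ‖a‖₊ := by
    have hconst : Filter.Tendsto (fun _ : ℕ => (‖a‖₊ : ENNReal)) Filter.atTop _ :=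
      tendsto_const_nhds
    refine tendsto_nhds_unique ?_ hconst
    convert! (spectrum.pow_nnnorm_pow_one_div_tendsto_nhds_spectralRadius (a : B)).comp
      (tendsto_pow_atTop_atTop_of_one_lt one_lt_two) using 1
    refine funext fun n => ?_
    rw [Function.comp_apply, hpow, ENNReal.coe_pow, ← ENNReal.rpow_natCast, ← ENNReal.rpow_mul]
    simp
  obtain ⟨z, hz, hzr⟩ := spectrum.exists_nnnorm_eq_spectralRadius (a : B)
  obtain ⟨φ, rfl⟩ := WeakDual.CharacterSpace.mem_spectrum_iff_exists.1 hz
  let ψ : B →ₐ[ℂ] ℂ := WeakDual.CharacterSpace.equivAlgHom φ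
  refine ⟨{ toRingHom := (ψ : B →+* ℂ).comp UniformSpace.Completion.coeRingHom
            commutes' := fun c => ψ.commutes c }, fun b => ?_, ?_⟩
  · have := AlgHom.norm_apply_le_self ψ (b : B)
    rwa [UniformSpace.Completion.norm_coe] at this
  · rw [hrad] at hzr
    exact congrArg NNReal.toReal (ENNReal.coe_injective hzr)

namespace IsCStarSeminorm

variable {A : Type*} [CommRing A] [Algebra ℂ A] [StarRing A]

/-- By commutativity `star (a ^ 2) * a ^ 2` is the square of the self-adjoint `star a * a`, so the
C⋆-identity applies twice. -/
theorem map_sq {p : Seminorm ℂ A} (hp : IsCStarSeminorm p) (a : A) : p (a ^ 2) = p a ^ 2 := by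
  have h : p (a ^ 2) ^ 2 = (p a ^ 2) ^ 2 := by
    have hsa : star (star a * a) = star a * a := by simp [mul_comm]
    have h1 := hp.star_mul_self (star a * a)
    rw [hsa] at h1
    calc p (a ^ 2) ^ 2 = p (star (a ^ 2) * a ^ 2) := (hp.star_mul_self _).symm
      _ = p ((star a * a) * (star a * a)) := by
        congr 1
        rw [star_pow]
        ring
      _ = (p a ^ 2) ^ 2 := by rw [h1, hp.star_mul_self]
  exact (pow_left_inj₀ (apply_nonneg p _) (sq_nonneg _) two_ne_zero).1 h

theorem map_one_le {p : Seminorm ℂ A} (hp : IsCStarSeminorm p) : p 1 ≤ 1 := by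
  have := hp.map_sq 1
  rw [one_pow] at this
  nlinarith [apply_nonneg p (1 : A)]

theorem map_pow_le {p : Seminorm ℂ A} (hp : IsCStarSeminorm p) (a : A) (n : ℕ) :
    p (a ^ n) ≤ p a ^ n := by
  induction n with
  | zero => simpa using hp.map_one_le
  | succ n ih =>
    rw [pow_succ, pow_succ]
    exact (hp.mul_le _ _).trans (mul_le_mul_of_nonneg_right ih (apply_nonneg p a))

theorem sup {p q : Seminorm ℂ A} (hp : IsCStarSeminorm p) (hq : IsCStarSeminorm q) :
    IsCStarSeminorm (p ⊔ q) where
  mul_le a b := by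
    rw [Seminorm.sup_apply, Seminorm.sup_apply, Seminorm.sup_apply]
    refine max_le ((hp.mul_le a b).trans ?_) ((hq.mul_le a b).trans ?_)
    · exact mul_le_mul (le_max_left _ _) (le_max_left _ _) (apply_nonneg p b)
        ((apply_nonneg p a).trans (le_max_left _ _))
    · exact mul_le_mul (le_max_right _ _) (le_max_right _ _) (apply_nonneg q b)
        ((apply_nonneg p a).trans (le_max_left _ _))
  star_mul_self a := by
    rw [Seminorm.sup_apply, Seminorm.sup_apply, hp.star_mul_self, hq.star_mul_self]
    rcases le_total (p a) (q a) with h | h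
    · rw [max_eq_right h, max_eq_right (pow_le_pow_left₀ (apply_nonneg p a) h 2)]
    · rw [max_eq_left h, max_eq_left (pow_le_pow_left₀ (apply_nonneg q a) h 2)]

theorem zero : IsCStarSeminorm (0 : Seminorm ℂ A) := ⟨by simp, by simp⟩

variable [StarModule ℂ A]

/-- A character bounded by a C⋆-seminorm is real on self-adjoint elements. -/
theorem im_apply_eq_zero {p : Seminorm ℂ A} (hp : IsCStarSeminorm p) (χ : A →ₐ[ℂ] ℂ)
    (hχ : ∀ a, ‖χ a‖ ≤ p a) {h : A} (hh : star h = h) : (χ h).im = 0 := by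
  -- Arens' trick: shift `h` by `it`. The `t ^ 2` terms cancel, leaving a bounded affine function of
  -- `t` with slope `2 * (χ h).im`.
  have key : ∀ t : ℝ, ‖χ h + t * Complex.I‖ ^ 2 ≤ p h ^ 2 + t ^ 2 := by
    intro t
    let b : A := h + algebraMap ℂ A (t * Complex.I)
    have hb : star b * b = h ^ 2 + algebraMap ℂ A ((t : ℂ) ^ 2) := by
      have h2 : star (algebraMap ℂ A (t * Complex.I)) = - algebraMap ℂ A (t * Complex.I) := by
        rw [← algebraMap_star_comm, ← map_neg]
        simp
      have h3 : algebraMap ℂ A ((t : ℂ) ^ 2)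
          = - (algebraMap ℂ A (t * Complex.I) * algebraMap ℂ A (t * Complex.I)) := by
        rw [← map_mul, ← map_neg]
        congr 1
        linear_combination (t : ℂ) ^ 2 * Complex.I_sq
      rw [star_add, h2, hh, h3]
      ring
    calc ‖χ h + t * Complex.I‖ ^ 2 = ‖χ b‖ ^ 2 := by simp [b]
      _ ≤ p b ^ 2 := pow_le_pow_left₀ (norm_nonneg _) (hχ b) 2
      _ = p (h ^ 2 + algebraMap ℂ A ((t : ℂ) ^ 2)) := by rw [← hp.star_mul_self, hb]
      _ ≤ p (h ^ 2) + p (algebraMap ℂ A ((t : ℂ) ^ 2)) := map_add_le_add p _ _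
      _ ≤ p h ^ 2 + t ^ 2 := by
        refine add_le_add (hp.map_sq h).le ?_
        rw [Algebra.algebraMap_eq_smul_one, map_smul_eq_mul]
        simpa using mul_le_of_le_one_right (sq_nonneg t) hp.map_one_le
  have key' : ∀ t : ℝ, (χ h).re ^ 2 + (χ h).im ^ 2 + 2 * (χ h).im * t ≤ p h ^ 2 := by
    intro t
    have := key t
    rw [← Complex.normSq_eq_norm_sq, Complex.normSq_apply] at this
    simp at this
    nlinarith
  by_contra hne
  have := key' ((p h ^ 2 + 1) / (2 * (χ h).im))
  rw [mul_div_cancel₀ _ (by simpa using hne)] at this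
  nlinarith [sq_nonneg (χ h).re, sq_nonneg (χ h).im]

/-- Both `a + star a` and `i (a - star a)` are self-adjoint, so `χ` is real on them. -/
theorem map_star_apply {p : Seminorm ℂ A} (hp : IsCStarSeminorm p) (χ : A →ₐ[ℂ] ℂ)
    (hχ : ∀ a, ‖χ a‖ ≤ p a) (a : A) : χ (star a) = star (χ a) := by
  have h1 := hp.im_apply_eq_zero χ hχ (h := a + star a) (by simp [add_comm])
  have h2 := hp.im_apply_eq_zero χ hχ (h := Complex.I • (a - star a)) (by
    rw [star_smul, star_sub, star_star]
    simp [← smul_neg])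
  simp at h1 h2
  apply Complex.ext
  · simp; linarith
  · simp; linarith

theorem exists_starAlgHom_norm_apply_eq {p : Seminorm ℂ A} (hp : IsCStarSeminorm p) (a : A)
    (ha : p a ≠ 0) : ∃ χ : A →⋆ₐ[ℂ] ℂ, (∀ b, ‖χ b‖ ≤ p b) ∧ ‖χ a‖ = p a := by
  let _ : SeminormedCommRing A :=
    { p.toAddGroupSeminorm.toSeminormedAddCommGroup, (inferInstance : CommRing A) with
      norm_mul_le := hp.mul_le }
  let _ : NormedAlgebra ℂ A :=
    { (inferInstance : Algebra ℂ A) with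
      norm_smul_le := fun c x => (map_smul_eq_mul p c x).le }
  obtain ⟨χ, h1, h2⟩ := exists_algHom_norm_apply_eq (R := A) hp.map_sq a ha
  exact ⟨{ χ with map_star' := hp.map_star_apply χ h1 }, h1, h2⟩

end IsCStarSeminorm

/-! ### The Gelfand representation of a commutative pro-C⋆-algebra -/

/-- The set of ⋆-characters bounded by the seminorm `p`, inside the product `A → ℂ`. -/
def characterBall {A : Type*} [Ring A] [Algebra ℂ A] [StarRing A] (p : Seminorm ℂ A) :
    Set (A → ℂ) :=
  {g | (∃ χ : A →⋆ₐ[ℂ] ℂ, ⇑χ = g) ∧ ∀ a, ‖g a‖ ≤ p a}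

/-- As in Banach–Alaoglu: the algebraic identities cut out a closed subset of a product of disks. -/
theorem isCompact_characterBall {A : Type*} [Ring A] [Algebra ℂ A] [StarRing A]
    (p : Seminorm ℂ A) : IsCompact (characterBall p) := by
  have hpi : IsCompact (Set.univ.pi fun a : A => Metric.closedBall (0 : ℂ) (p a)) :=
    isCompact_univ_pi fun a => isCompact_closedBall _ _
  let C : Set (A → ℂ) := ({g | g 1 = 1} ∩ {g | ∀ a b, g (a * b) = g a * g b}) ∩
    ({g | ∀ a b, g (a + b) = g a + g b} ∩ ({g | ∀ c : ℂ, g (algebraMap ℂ A c) = c} ∩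
      {g | ∀ a, g (star a) = star (g a)}))
  have hC : IsClosed C := by
    have hev : ∀ a : A, Continuous fun g : A → ℂ => g a := continuous_apply
    refine IsClosed.inter (IsClosed.inter (isClosed_eq (hev _) continuous_const) ?_)
      (IsClosed.inter ?_ (IsClosed.inter ?_ ?_))
    · simp only [Set.ofPred_forall]
      exact isClosed_iInter fun a => isClosed_iInter fun b =>
        isClosed_eq (hev _) ((hev a).mul (hev b))
    · simp only [Set.ofPred_forall]
      exact isClosed_iInter fun a => isClosed_iInter fun b =>
        isClosed_eq (hev _) ((hev a).add (hev b))
    · simp only [Set.ofPred_forall]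
      exact isClosed_iInter fun c => isClosed_eq (hev _) continuous_const
    · simp only [Set.ofPred_forall]
      exact isClosed_iInter fun a => isClosed_eq (hev _) (hev a).star
  convert hpi.inter_right hC using 1
  ext g
  constructor
  · rintro ⟨⟨χ, rfl⟩, hg⟩
    exact ⟨fun a _ => by simpa using hg a, ⟨map_one χ, map_mul χ⟩, map_add χ,
      fun c => AlgHomClass.commutes χ c, map_star χ⟩
  · rintro ⟨hg, ⟨h1, hm⟩, ha, hc, hs⟩
    refine ⟨⟨{ toFun := g, map_one' := h1, map_mul' := hm, map_add' := ha, map_star' := hs,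
               map_zero' := by simpa using hc 0, commutes' := hc }, rfl⟩, fun a => ?_⟩
    simpa using hg a trivial

/-- The spectrum of a topological ⋆-algebra: the ⋆-characters bounded by some continuous
C⋆-seminorm, with the topology of pointwise convergence. -/
def continuousCharacters (A : Type*) [Ring A] [Algebra ℂ A] [StarRing A] [TopologicalSpace A] :
    Set (A → ℂ) :=
  {g | ∃ p : ContCStarSeminorm A, g ∈ characterBall p.1}

/-- The part of the spectrum bounded by `p`. -/
def spectrumBall {A : Type*} [Ring A] [Algebra ℂ A] [StarRing A] [TopologicalSpace A]
    (p : ContCStarSeminorm A) : Set (continuousCharacters A) :=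
  Subtype.val ⁻¹' characterBall p.1

theorem isCompact_spectrumBall {A : Type*} [Ring A] [Algebra ℂ A] [StarRing A]
    [TopologicalSpace A] (p : ContCStarSeminorm A) : IsCompact (spectrumBall p) := by
  refine (IsInducing.subtypeVal.isCompact_preimage_iff ?_).2 (isCompact_characterBall p.1)
  rw [Subtype.range_coe]
  exact fun g hg => ⟨p, hg⟩

/-- The Gelfand homomorphism. -/
def gelfandHom (A : Type*) [Ring A] [Algebra ℂ A] [StarRing A] [TopologicalSpace A] :
    A →⋆ₐ[ℂ] C(continuousCharacters A, ℂ) where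
  toFun a := ⟨fun x => x.1 a, (continuous_apply a).comp continuous_subtype_val⟩
  map_one' := by
    ext ⟨_, p, ⟨χ, rfl⟩, hg⟩
    exact map_one χ
  map_mul' a b := by
    ext ⟨_, p, ⟨χ, rfl⟩, hg⟩
    exact map_mul χ a b
  map_zero' := by
    ext ⟨_, p, ⟨χ, rfl⟩, hg⟩
    exact map_zero χ
  map_add' a b := by
    ext ⟨_, p, ⟨χ, rfl⟩, hg⟩
    exact map_add χ a b
  commutes' c := by
    ext ⟨_, p, ⟨χ, rfl⟩, hg⟩
    exact AlgHomClass.commutes χ c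
  map_star' a := by
    ext ⟨_, p, ⟨χ, rfl⟩, hg⟩
    exact map_star χ a

/-! ### The Gelfand map: bijectivity, and continuity under barreledness -/

section Gelfand

variable {A : Type*} [CommRing A] [Algebra ℂ A] [StarRing A]

theorem gelfandHom_apply [TopologicalSpace A] (a : A) (x : continuousCharacters A) :
    gelfandHom A a x = x.1 a := rfl

theorem norm_gelfandHom_le [TopologicalSpace A] {p : ContCStarSeminorm A}
    {x : continuousCharacters A} (hx : x ∈ spectrumBall p) (a : A) :
    ‖gelfandHom A a x‖ ≤ p.1 a := hx.2 a

/-- A nonzero `p a` is attained by a character, so the strict bound survives the supremum. -/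
theorem ContCStarSeminorm.lt_of_forall_spectrumBall [TopologicalSpace A] [StarModule ℂ A]
    (p : ContCStarSeminorm A) {a : A} {ε : ℝ} (hε : 0 < ε)
    (h : ∀ x ∈ spectrumBall p, ‖gelfandHom A a x‖ < ε) : p.1 a < ε := by
  by_cases ha : p.1 a = 0
  · rwa [ha]
  · obtain ⟨χ, h1, h2⟩ := p.2.1.exists_starAlgHom_norm_apply_eq a ha
    rw [← h2]
    exact h ⟨χ, p, ⟨χ, rfl⟩, h1⟩ ⟨⟨χ, rfl⟩, h1⟩

/-- Basic neighborhoods of zero involve finitely many seminorms; this reduces them to one. -/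
theorem ContCStarSeminorm.exists_eq_finset_sup [TopologicalSpace A]
    (s : Finset (ContCStarSeminorm A)) :
    ∃ q : ContCStarSeminorm A, s.sup (fun p : ContCStarSeminorm A => p.1) = q.1 := by
  classical
  induction s using Finset.induction with
  | empty => exact ⟨⟨0, IsCStarSeminorm.zero, continuous_const⟩, rfl⟩
  | insert p s _ ih =>
    obtain ⟨q, hq⟩ := ih
    refine ⟨⟨p.1 ⊔ q.1, p.2.1.sup q.2.1, p.2.2.max q.2.2⟩, ?_⟩
    rw [Finset.sup_insert, hq]

/-- Stone–Weierstrass on the compact set `spectrumBall p`. -/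
theorem exists_norm_gelfandHom_sub_lt [TopologicalSpace A] (f : C(continuousCharacters A, ℂ))
    (p : ContCStarSeminorm A) {ε : ℝ} (hε : 0 < ε) :
    ∃ a : A, ∀ x ∈ spectrumBall p, ‖gelfandHom A a x - f x‖ < ε := by
  have : CompactSpace (spectrumBall p) := isCompact_iff_compactSpace.1 (isCompact_spectrumBall p)
  let i : C(spectrumBall p, continuousCharacters A) := ⟨Subtype.val, continuous_subtype_val⟩
  let Φ : A →⋆ₐ[ℂ] C(spectrumBall p, ℂ) :=
    (ContinuousMap.compStarAlgHom' ℂ ℂ i).comp (gelfandHom A)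
  have hsep : Φ.range.SeparatesPoints := by
    intro x y hxy
    have : x.1.1 ≠ y.1.1 := fun h => hxy (Subtype.ext (Subtype.ext h))
    obtain ⟨a, ha⟩ := Function.ne_iff.1 this
    exact ⟨Φ a, ⟨Φ a, ⟨a, rfl⟩, rfl⟩, ha⟩
  have htop := ContinuousMap.starSubalgebra_topologicalClosure_eq_top_of_separatesPoints _ hsep
  have hf : f.comp i ∈ Φ.range.topologicalClosure := htop ▸ trivial
  obtain ⟨_, ⟨a, rfl⟩, ha⟩ := Metric.mem_closure_iff.1 hf ε hε
  refine ⟨a, fun x hx => ?_⟩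
  have := (ContinuousMap.dist_lt_iff hε).1 ha ⟨x, hx⟩
  rwa [dist_comm, dist_eq_norm] at this

variable [UniformSpace A] [IsProCStarAlgebra A]

theorem continuous_gelfandHom_apply (x : continuousCharacters A) :
    Continuous fun a => gelfandHom A a x := by
  obtain ⟨p, hp⟩ := x.2
  let L : A →ₗ[ℂ] ℂ :=
    ((ContinuousMap.evalStarAlgHom ℂ ℂ x).comp (gelfandHom A)).toAlgHom.toLinearMap
  refine continuous_of_continuousAt_zero L ?_
  rw [ContinuousAt, map_zero]
  refine squeeze_zero_norm (fun a => norm_gelfandHom_le (p := p) hp a) ?_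
  simpa using p.2.2.tendsto 0

theorem injective_gelfandHom : Function.Injective (gelfandHom A) := by
  rw [injective_iff_map_eq_zero]
  intro a ha
  by_contra hne
  obtain ⟨p, hp⟩ := (IsProCStarAlgebra.withSeminorms (A := A)).separating_of_T1 a hne
  refine hp (le_antisymm ?_ (apply_nonneg _ _))
  refine le_of_forall_pos_lt_add fun ε hε => ?_
  rw [zero_add]
  exact p.lt_of_forall_spectrumBall hε fun x _ => by simpa [ha] using hε

/-- The elements approximating `f` within `ε` on `spectrumBall p` generate a Cauchy filter as `p`
and `ε` vary; its limit is the preimage of `f`. -/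
theorem surjective_gelfandHom : Function.Surjective (gelfandHom A) := by
  intro f
  let V : ContCStarSeminorm A × {ε : ℝ // 0 < ε} → Set A := fun q =>
    {a | ∀ x ∈ spectrumBall q.1, ‖gelfandHom A a x - f x‖ < q.2}
  have hne : Nonempty (ContCStarSeminorm A × {ε : ℝ // 0 < ε}) :=
    ⟨⟨0, IsCStarSeminorm.zero, continuous_const⟩, 1, one_pos⟩
  have hdir : Directed (· ≥ ·) V := by
    rintro ⟨p, ε, hε⟩ ⟨q, δ, hδ⟩
    refine ⟨(⟨p.1 ⊔ q.1, p.2.1.sup q.2.1, p.2.2.max q.2.2⟩, ⟨min ε δ, lt_min hε hδ⟩),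
      fun a ha x hx => ?_, fun a ha x hx => ?_⟩
    · exact (ha x ⟨hx.1, fun b => (hx.2 b).trans (le_max_left _ _)⟩).trans_le (min_le_left _ _)
    · exact (ha x ⟨hx.1, fun b => (hx.2 b).trans (le_max_right _ _)⟩).trans_le (min_le_right _ _)
  let F : Filter A := ⨅ q, Filter.principal (V q)
  have hV : ∀ q, V q ∈ F := fun q => Filter.mem_iInf_of_mem q (Filter.mem_principal_self _)
  have hF : F.NeBot := (Filter.hasBasis_iInf_principal hdir).neBot_iff.2 fun {q} _ =>
    exists_norm_gelfandHom_sub_lt f q.1 q.2.2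
  have hcauchy : Cauchy F := by
    refine ⟨hF, ?_⟩
    rw [uniformity_eq_comap_nhds_zero, ← Filter.tendsto_iff_comap,
      (IsProCStarAlgebra.withSeminorms (A := A)).tendsto_nhds]
    intro p ε hε
    have hV' := hV (p, ⟨ε / 2, half_pos hε⟩)
    filter_upwards [Filter.prod_mem_prod hV' hV'] with ab hab
    refine p.lt_of_forall_spectrumBall hε fun x hx => ?_
    have h1 : ‖gelfandHom A ab.1 x - f x‖ < ε / 2 := hab.1 x hx
    have h2 : ‖gelfandHom A ab.2 x - f x‖ < ε / 2 := hab.2 x hx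
    rw [sub_zero, map_sub, ContinuousMap.sub_apply]
    calc _ = ‖(gelfandHom A ab.2 x - f x) - (gelfandHom A ab.1 x - f x)‖ := by congr 1; ring
      _ ≤ _ := norm_sub_le _ _
      _ < ε := by linarith
  obtain ⟨a, ha⟩ := CompleteSpace.complete hcauchy
  refine ⟨a, ContinuousMap.ext fun x => ?_⟩
  refine tendsto_nhds_unique (((continuous_gelfandHom_apply x).tendsto a).mono_left ha) ?_
  rw [Metric.tendsto_nhds]
  intro ε hε
  obtain ⟨p, hp⟩ := x.2
  filter_upwards [hV (p, ⟨ε, hε⟩)] with b hb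
  rw [dist_eq_norm]
  exact hb x hp

theorem isClosed_setOf_norm_gelfandHom_le (S : Set (continuousCharacters A)) :
    IsClosed {a : A | ∀ x ∈ S, ‖gelfandHom A a x‖ ≤ 1} := by
  simp only [Set.ofPred_forall]
  exact isClosed_iInter fun x => isClosed_iInter fun _ =>
    isClosed_le (continuous_gelfandHom_apply x).norm continuous_const

/-- In a barreled algebra, pointwise bounded sets of characters are equicontinuous. -/
theorem IsBarreled.exists_subset_spectrumBall (hA : IsBarreled A)
    (S : Set (continuousCharacters A)) (hS : ∀ a : A, ∃ C, ∀ x ∈ S, ‖gelfandHom A a x‖ ≤ C) :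
    ∃ p : ContCStarSeminorm A, S ⊆ spectrumBall p := by
  have hB : IsBarrel {a : A | ∀ x ∈ S, ‖gelfandHom A a x‖ ≤ 1} :=
    { balanced := by
        rw [balanced_iff_smul_mem]
        intro c hc a ha x hx
        rw [map_smul, ContinuousMap.smul_apply, norm_smul]
        exact mul_le_one₀ hc (norm_nonneg _) (ha x hx)
      convex := by
        intro a ha b hb s t hs ht hst x hx
        have h1 : ∀ (r : ℝ) (c : A), gelfandHom A (r • c) x = r * gelfandHom A c x := by
          intro r c
          rw [← Complex.coe_smul, map_smul, ContinuousMap.smul_apply, smul_eq_mul]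
        rw [map_add, ContinuousMap.add_apply, h1, h1]
        refine (norm_add_le _ _).trans ?_
        rw [norm_mul, norm_mul, Complex.norm_of_nonneg hs, Complex.norm_of_nonneg ht]
        nlinarith [ha x hx, hb x hx]
      absorbent := by
        intro a
        obtain ⟨C, hC⟩ := hS a
        refine absorbs_iff_norm.2 ⟨max C 1, fun c hc => ?_⟩
        have hc0 : 0 < ‖c‖ := one_pos.trans_le ((le_max_right _ _).trans hc)
        rw [Set.singleton_subset_iff, Set.mem_smul_set_iff_inv_smul_mem₀ (norm_pos_iff.1 hc0)]
        intro x hx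
        rw [map_smul, ContinuousMap.smul_apply, norm_smul, norm_inv, inv_mul_le_one₀ hc0]
        exact (hC x hx).trans ((le_max_left _ _).trans hc)
      isClosed := isClosed_setOf_norm_gelfandHom_le S }
  obtain ⟨s, r, hr, hsr⟩ :=
    ((IsProCStarAlgebra.withSeminorms (A := A)).mem_nhds_iff 0 _).1 (hA _ hB)
  obtain ⟨p, hp⟩ := ContCStarSeminorm.exists_eq_finset_sup s
  rw [hp] at hsr
  refine ⟨p, fun x hx => ?_⟩
  -- Only the fact that `x` is a ⋆-character is kept; its own bounding seminorm is forgotten.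
  have hx' := x.2.choose_spec.1
  refine ⟨hx', fun a => ?_⟩
  by_contra! hlt
  have hpos : 0 < ‖gelfandHom A a x‖ := (apply_nonneg _ _).trans_lt hlt
  have hne : gelfandHom A a x ≠ 0 := norm_pos_iff.1 hpos
  -- Powers sharpen the bound to constant one: `p (b ^ n)` tends to zero while `x` takes the value 1
  -- at `b ^ n`, so `2 • b ^ n` eventually lies in the ball but not in the barrel.
  let b : A := (gelfandHom A a x)⁻¹ • a
  have hb : gelfandHom A b x = 1 := by
    rw [map_smul, ContinuousMap.smul_apply, smul_eq_mul, inv_mul_cancel₀ hne]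
  have hpb : p.1 b < 1 := by
    rw [map_smul_eq_mul, norm_inv, inv_mul_lt_one₀ hpos]
    exact hlt
  obtain ⟨n, hn⟩ := exists_pow_lt_of_lt_one (half_pos hr) hpb
  have hmem : (2 : ℂ) • b ^ n ∈ p.1.ball 0 r := by
    rw [Seminorm.mem_ball_zero, map_smul_eq_mul, Complex.norm_two]
    linarith [p.2.1.map_pow_le b n]
  have := hsr hmem x hx
  rw [map_smul, map_pow, ContinuousMap.smul_apply, ContinuousMap.pow_apply, hb] at this
  norm_num at this

/-- In the spectrum of a barreled algebra, relatively pseudocompact sets are relatively compact. -/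
theorem IsBarreled.isRelCompact_of_isRelPseudocompact (hA : IsBarreled A)
    (S : Set (continuousCharacters A)) (hS : IsRelPseudocompact S) : IsRelCompact S := by
  obtain ⟨p, hp⟩ := hA.exists_subset_spectrumBall S fun a => by
    obtain ⟨C, hC⟩ := isBounded_iff_forall_norm_le.1
      (hS ⟨fun x => ‖gelfandHom A a x‖, (gelfandHom A a).continuous.norm⟩)
    refine ⟨C, fun x hx => ?_⟩
    simpa using hC _ ⟨x, hx, rfl⟩
  exact (isCompact_spectrumBall p).closure_of_subset hp

/-- A barreled commutative pro-C⋆-algebra is, as a topological ⋆-algebra, the algebra of continuous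
functions on its spectrum. -/
theorem IsBarreled.isHomeomorph_gelfandHom (hA : IsBarreled A) :
    IsHomeomorph (StarAlgEquiv.ofBijective (gelfandHom A)
      ⟨injective_gelfandHom, surjective_gelfandHom⟩) := by
  let e := StarAlgEquiv.ofBijective (gelfandHom A) ⟨injective_gelfandHom, surjective_gelfandHom⟩
  have he : ∀ a, e a = gelfandHom A a := fun _ => rfl
  have hcont : Continuous e := by
    refine continuous_of_continuousAt_zero e ?_
    rw [ContinuousAt, map_zero, (ContinuousMap.hasBasis_nhds_norm_sub 0).tendsto_right_iff]
    rintro ⟨K, δ⟩ ⟨hK, hδ⟩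
    obtain ⟨p, hp⟩ := hA.exists_subset_spectrumBall K fun a => by
      obtain ⟨C, hC⟩ := hK.exists_bound_of_continuousOn (gelfandHom A a).continuous.continuousOn
      exact ⟨C, hC⟩
    have h0 : ∀ᶠ a in 𝓝 (0 : A), p.1 a < δ :=
      p.2.2.tendsto' 0 0 (map_zero p.1) |>.eventually_lt_const hδ
    filter_upwards [h0] with a ha x hx
    rw [ContinuousMap.zero_apply, sub_zero]
    exact (norm_gelfandHom_le (hp hx) a).trans_lt ha
  -- This direction needs no barreledness: `p` is controlled by values on the compact set
  -- `spectrumBall p`.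
  have hsymm : Continuous e.symm := by
    let L : C(continuousCharacters A, ℂ) →ₗ[ℂ] A :=
      { toFun := e.symm
        map_add' := map_add e.symm
        map_smul' := fun c f => map_smul e.symm c f }
    refine (IsProCStarAlgebra.withSeminorms (A := A)).continuous_of_continuous_comp L fun p => ?_
    refine Seminorm.continuous' (r := 1) ?_
    filter_upwards [ContinuousMap.setOf_norm_lt_mem_nhds_zero (isCompact_spectrumBall p) one_pos]
      with f hf
    rw [Seminorm.mem_closedBall_zero]
    refine (p.lt_of_forall_spectrumBall one_pos fun x hx => ?_).le
    have : gelfandHom A (L f) = f := e.apply_symm_apply f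
    rw [this]
    exact hf x hx
  exact (Homeomorph.mk e.toEquiv hcont hsymm).isHomeomorph

end Gelfand

/-! ### The Nachbin–Shirota theorem -/

namespace ContinuousMap

variable {X : Type*} [TopologicalSpace X]

/-- The sum `∑ cₙ fₙ`, intended for functions `fₙ` vanishing outside `{g > n}`. -/
noncomputable def sumAbove (g : C(X, ℝ)) (f : ℕ → C(X, ℂ)) (x : X) (c : ℕ → ℂ) : ℂ :=
  ∑ n ∈ Finset.range ⌈g x⌉₊, c n * f n x

theorem sumAbove_eq {g : C(X, ℝ)} {f : ℕ → C(X, ℂ)}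
    (hf : ∀ (n : ℕ) x, g x ≤ n → f n x = 0) {x : X} {N : ℕ} (hN : g x ≤ N) (c : ℕ → ℂ) :
    g.sumAbove f x c = ∑ n ∈ Finset.range N, c n * f n x := by
  refine Finset.sum_subset (Finset.range_subset_range.2 (Nat.ceil_le.2 hN)) fun n _ hn => ?_
  rw [Finset.mem_range, not_lt] at hn
  rw [hf n x (Nat.ceil_le.1 hn), mul_zero]

/-- Where `g < N` the sum has at most `N` nonzero terms. Joint continuity allows currying into the
compact-open topology. -/
theorem continuous_sumAbove {g : C(X, ℝ)} {f : ℕ → C(X, ℂ)}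
    (hf : ∀ (n : ℕ) x, g x ≤ n → f n x = 0) :
    Continuous fun q : (ℕ → ℂ) × X => g.sumAbove f q.2 q.1 := by
  rw [continuous_iff_continuousAt]
  rintro ⟨c, x⟩
  obtain ⟨N, hN⟩ := exists_nat_gt (g x)
  have hnhds : {q : (ℕ → ℂ) × X | g q.2 < N} ∈ 𝓝 (c, x) :=
    (isOpen_lt (g.continuous.comp continuous_snd) continuous_const).mem_nhds hN
  have hcont : Continuous fun q : (ℕ → ℂ) × X => ∑ n ∈ Finset.range N, q.1 n * f n q.2 := by
    fun_prop
  refine hcont.continuousAt.congr ?_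
  filter_upwards [hnhds] with q hq
  exact (sumAbove_eq hf (le_of_lt hq) q.1).symm

end ContinuousMap

/-! ### Supports of seminorms on `C(X, ℂ)` -/

namespace Seminorm

variable {X : Type*} [TopologicalSpace X]

/-- The functions all of whose multiples are in the kernel of the seminorm `p`. -/
def kernelIdeal (p : Seminorm ℂ C(X, ℂ)) : Ideal C(X, ℂ) where
  carrier := {φ | ∀ h, p (h * φ) = 0}
  zero_mem' h := by simp
  add_mem' {φ ψ} hφ hψ h := by
    refine le_antisymm ?_ (apply_nonneg p _)
    rw [mul_add]
    exact (map_add_le_add p _ _).trans (by rw [hφ h, hψ h, add_zero])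
  smul_mem' c φ hφ h := by
    rw [smul_eq_mul, ← mul_assoc]
    exact hφ _

/-- The support of a seminorm on `C(X, ℂ)`: the zero set of its kernel ideal. -/
def functionSupport (p : Seminorm ℂ C(X, ℂ)) : Set X :=
  {x | ∀ φ ∈ p.kernelIdeal, φ x = 0}

theorem isClosed_functionSupport (p : Seminorm ℂ C(X, ℂ)) : IsClosed p.functionSupport := by
  have : p.functionSupport = ⋂ φ ∈ p.kernelIdeal, {x | φ x = 0} := by
    ext x
    simp [functionSupport]
  rw [this]
  exact isClosed_iInter fun φ => isClosed_iInter fun _ => isClosed_eq φ.continuous continuous_const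

/-- Near each point of its support, the seminorm does not vanish. -/
theorem exists_apply_ne_zero_of_mem_functionSupport [CompletelyRegularSpace X]
    {p : Seminorm ℂ C(X, ℂ)} {x : X} (hx : x ∈ p.functionSupport) {U : Set X} (hU : IsOpen U)
    (hxU : x ∈ U) : ∃ f : C(X, ℂ), (∀ y ∉ U, f y = 0) ∧ p f ≠ 0 := by
  by_contra! hcon
  obtain ⟨f, hf, h0, h1⟩ := CompletelyRegularSpace.completely_regular_isOpen x U hU hxU
  -- If `p` killed every function vanishing off `U`, this bump would lie in the kernel ideal, yet it
  -- is 1 at `x`.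
  let φ : C(X, ℂ) := ⟨fun y => ((1 - (f y : ℝ) : ℝ) : ℂ), by fun_prop⟩
  have hφU : ∀ y ∉ U, φ y = 0 := by
    intro y hy
    have : f y = 1 := h1 hy
    simp [φ, this]
  have hφ : φ ∈ p.kernelIdeal := fun h => hcon _ fun y hy => by
    rw [ContinuousMap.mul_apply, hφU y hy, mul_zero]
  have := hx φ hφ
  simp [φ, h0] at this

/-- A gliding hump. If `g` is unbounded on the support, there are `f n` vanishing off `{g > n}` with
`p (f n) ≠ 0`, and `c ↦ ∑ cₙ fₙ` is continuous on the Fréchet, hence barrelled, space `ℕ → ℂ`. So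
`p` composed with it is continuous, but it equals 1 along the null sequence `u`. -/
theorem isRelPseudocompact_functionSupport [CompletelyRegularSpace X]
    {p : Seminorm ℂ C(X, ℂ)} (hp : LowerSemicontinuous p) :
    IsRelPseudocompact p.functionSupport := by
  intro g₀
  let g : C(X, ℝ) := ⟨fun x => ‖g₀ x‖, g₀.continuous.norm⟩
  by_contra hbdd
  have hunb : ∀ n : ℕ, ∃ x ∈ p.functionSupport, (n : ℝ) < g x := by
    intro n
    by_contra! hn
    refine hbdd (isBounded_iff_forall_norm_le.2 ⟨n, ?_⟩)
    rintro _ ⟨x, hx, rfl⟩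
    exact hn x hx
  have hex : ∀ n : ℕ, ∃ f : C(X, ℂ), (∀ y, g y ≤ n → f y = 0) ∧ p f ≠ 0 := by
    intro n
    obtain ⟨x, hx, hxn⟩ := hunb n
    obtain ⟨f, hf, hpf⟩ := exists_apply_ne_zero_of_mem_functionSupport hx
      (U := {y | (n : ℝ) < g y})
      (isOpen_lt continuous_const g.continuous) hxn
    exact ⟨f, fun y hy => hf y (not_lt.2 hy), hpf⟩
  choose f hf hpf using hex
  have hcont := ContinuousMap.continuous_sumAbove hf
  let T : (ℕ → ℂ) →ₗ[ℂ] C(X, ℂ) :=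
    { toFun := fun c => ⟨fun x => g.sumAbove f x c, hcont.comp (Continuous.prodMk_right c)⟩
      map_add' := fun c d => by
        ext x
        simp [ContinuousMap.sumAbove, add_mul, Finset.sum_add_distrib]
      map_smul' := fun r c => by
        ext x
        simp [ContinuousMap.sumAbove, mul_assoc, Finset.mul_sum] }
  have hT : Continuous T := ContinuousMap.continuous_of_continuous_uncurry _ hcont
  have hq : Continuous (p.comp T) :=
    (p.comp T).continuous_of_lowerSemicontinuous (hp.comp hT)
  have hsingle : ∀ n, T (Pi.single n 1) = f n := by
    intro n
    ext x
    obtain ⟨N, hN⟩ := exists_nat_ge (max (g x) (n + 1))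
    have hn : n < N := by exact_mod_cast (le_max_right _ _).trans hN
    refine (ContinuousMap.sumAbove_eq hf ((le_max_left _ _).trans hN) _).trans ?_
    rw [Finset.sum_eq_single_of_mem n (Finset.mem_range.2 hn)]
    · simp
    · intro m _ hm
      simp [Pi.single_eq_of_ne hm]
  let u : ℕ → ℕ → ℂ := fun n => ((p (f n) : ℂ))⁻¹ • Pi.single n 1
  have hu : Filter.Tendsto u Filter.atTop (𝓝 0) := by
    rw [tendsto_pi_nhds]
    intro m
    -- Each coordinate is eventually zero, however small `p (f n)` is.
    refine tendsto_const_nhds.congr' ?_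
    filter_upwards [Filter.eventually_gt_atTop m] with n hn
    simp [u, Pi.single_eq_of_ne hn.ne]
  have hlim := (hq.tendsto 0).comp hu
  rw [map_zero] at hlim
  have hone : (p.comp T) ∘ u = fun _ => 1 := by
    funext n
    rw [Function.comp_apply, map_smul_eq_mul, Seminorm.comp_apply, hsingle, norm_inv,
      Complex.norm_of_nonneg (apply_nonneg p _), inv_mul_cancel₀ (hpf n)]
  rw [hone] at hlim
  exact one_ne_zero (tendsto_nhds_unique tendsto_const_nhds hlim)

/-- A compact set disjoint from the support carries a cut-off function from the kernel ideal. -/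
theorem exists_mem_kernelIdeal_eq_one (p : Seminorm ℂ C(X, ℂ)) {L : Set X} (hL : IsCompact L)
    (hdisj : ∀ x ∈ L, x ∉ p.functionSupport) :
    ∃ φ ∈ p.kernelIdeal, (∀ x ∈ L, φ x = 1) ∧ ∀ x, ‖1 - φ x‖ ≤ 1 := by
  have hpos : ∃ ψ : C(X, ℝ), (∀ x, 0 ≤ ψ x) ∧ (∀ x ∈ L, 0 < ψ x) ∧
      (⟨fun x => (ψ x : ℂ), by fun_prop⟩ : C(X, ℂ)) ∈ p.kernelIdeal := by
    -- Near a point, `|φ|²` with `φ` in the ideal works; sums of such functions cover unions.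
    refine hL.induction_on (p := fun L => ∃ ψ : C(X, ℝ), (∀ x, 0 ≤ ψ x) ∧ (∀ x ∈ L, 0 < ψ x) ∧
      (⟨fun x => (ψ x : ℂ), by fun_prop⟩ : C(X, ℂ)) ∈ p.kernelIdeal) ?_ ?_ ?_ ?_
    · refine ⟨0, fun _ => le_rfl, by simp, ?_⟩
      convert p.kernelIdeal.zero_mem using 1
      ext x
      simp
    · rintro s t hst ⟨ψ, h1, h2, h3⟩
      exact ⟨ψ, h1, fun x hx => h2 x (hst hx), h3⟩
    · rintro s t ⟨ψ, h1, h2, h3⟩ ⟨θ, k1, k2, k3⟩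
      refine ⟨ψ + θ, fun x => add_nonneg (h1 x) (k1 x), ?_, ?_⟩
      · rintro x (hx | hx)
        · exact add_pos_of_pos_of_nonneg (h2 x hx) (k1 x)
        · exact add_pos_of_nonneg_of_pos (h1 x) (k2 x hx)
      · convert p.kernelIdeal.add_mem h3 k3 using 1
        ext x
        simp
    · intro x hx
      have := hdisj x hx
      simp only [functionSupport, Set.mem_ofPred_eq, not_forall] at this
      obtain ⟨φ, hφ, hφx⟩ := this
      refine ⟨{y | φ y ≠ 0}, mem_nhdsWithin_of_mem_nhds
        ((isOpen_ne_fun φ.continuous continuous_const).mem_nhds hφx),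
        ⟨fun y => Complex.normSq (φ y), by fun_prop⟩, fun y => Complex.normSq_nonneg _,
        fun y hy => Complex.normSq_pos.2 hy, ?_⟩
      convert p.kernelIdeal.mul_mem_left (star φ) hφ using 1
      ext y
      exact Complex.normSq_eq_conj_mul_self
  obtain ⟨ψ, h1, h2, h3⟩ := hpos
  have hδ : ∃ δ > 0, ∀ x ∈ L, δ ≤ ψ x := by
    rcases L.eq_empty_or_nonempty with rfl | hne
    · exact ⟨1, one_pos, by simp⟩
    · obtain ⟨x, hx, hmin⟩ := hL.exists_isMinOn hne ψ.continuous.continuousOn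
      exact ⟨ψ x, h2 x hx, fun y hy => hmin hy⟩
  obtain ⟨δ, hδ, hδL⟩ := hδ
  have hmax : ∀ x, 0 < max (ψ x) δ := fun x => hδ.trans_le (le_max_right _ _)
  -- Dividing `ψ` by `max ψ δ` avoids its zeros, gives 1 on `L`, and keeps values in `[0, 1]`.
  let θ : C(X, ℂ) := ⟨fun x => (((max (ψ x) δ)⁻¹ : ℝ) : ℂ), by
    have : Continuous fun x => (max (ψ x) δ)⁻¹ :=
      (ψ.continuous.max continuous_const).inv₀ fun x => (hmax x).ne'
    fun_prop⟩
  refine ⟨_, p.kernelIdeal.mul_mem_left θ h3, fun x hx => ?_, fun x => ?_⟩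
  · change (((max (ψ x) δ)⁻¹ : ℝ) : ℂ) * (ψ x : ℂ) = 1
    rw [max_eq_left (hδL x hx), ← Complex.ofReal_mul, inv_mul_cancel₀ (h2 x hx).ne']
    simp
  · change ‖1 - (((max (ψ x) δ)⁻¹ : ℝ) : ℂ) * (ψ x : ℂ)‖ ≤ 1
    rw [← Complex.ofReal_mul, ← Complex.ofReal_one, ← Complex.ofReal_sub, Complex.norm_real,
      Real.norm_eq_abs, abs_le]
    have h4 : (max (ψ x) δ)⁻¹ * ψ x ≤ 1 := by
      rw [inv_mul_le_one₀ (hmax x)]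
      exact le_max_left _ _
    have h5 : 0 ≤ (max (ψ x) δ)⁻¹ * ψ x := mul_nonneg (inv_nonneg.2 (hmax x).le) (h1 x)
    constructor <;> linarith

/-- Products `f * φ` with `φ` in the kernel ideal approximate `f` uniformly on compact sets, and the
zero set of `p` is closed by lower semicontinuity. The cut-off need only be 1 where `|f| ≥ δ / 2`,
away from the support. -/
theorem apply_eq_zero_of_forall_functionSupport {p : Seminorm ℂ C(X, ℂ)}
    (hp : LowerSemicontinuous p) {f : C(X, ℂ)} (hf : ∀ x ∈ p.functionSupport, f x = 0) :
    p f = 0 := by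
  have hclosed : IsClosed {f | p f ≤ 0} := hp.isClosed_preimage 0
  refine le_antisymm ?_ (apply_nonneg p f)
  refine hclosed.closure_subset
    ((mem_closure_iff_nhds_basis (ContinuousMap.hasBasis_nhds_norm_sub f)).2 ?_)
  rintro ⟨L, δ⟩ ⟨hL, hδ⟩
  have hclosed' : IsClosed {x | δ / 2 ≤ ‖f x‖} := isClosed_le continuous_const f.continuous.norm
  obtain ⟨φ, hφ, hφ1, hφ2⟩ := p.exists_mem_kernelIdeal_eq_one (hL.inter_right hclosed')
    fun x hx hxs => by
      have : δ / 2 ≤ ‖f x‖ := hx.2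
      rw [hf x hxs, norm_zero] at this
      linarith
  refine ⟨f * φ, (hφ f).le, fun x hx => ?_⟩
  by_cases hxδ : δ / 2 ≤ ‖f x‖
  · simpa [hφ1 x ⟨hx, hxδ⟩] using hδ
  · have : (f * φ) x - f x = -(f x * (1 - φ x)) := by
      rw [ContinuousMap.mul_apply]
      ring
    rw [this, norm_neg, norm_mul]
    calc ‖f x‖ * ‖1 - φ x‖ ≤ ‖f x‖ * 1 := mul_le_mul_of_nonneg_left (hφ2 x) (norm_nonneg _)
      _ < δ := by linarith

end Seminorm

/-- The inclusion of the bounded continuous functions into all continuous functions. -/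
def BoundedContinuousFunction.toContinuousMapLinear (X : Type*) [TopologicalSpace X] :
    BoundedContinuousFunction X ℂ →ₗ[ℂ] C(X, ℂ) where
  toFun f := f.toContinuousMap
  map_add' _ _ := rfl
  map_smul' _ _ := rfl

theorem BoundedContinuousFunction.continuous_toContinuousMapLinear (X : Type*)
    [TopologicalSpace X] : Continuous (toContinuousMapLinear X) := by
  refine continuous_of_continuousAt_zero _ ?_
  rw [ContinuousAt, map_zero, (ContinuousMap.hasBasis_nhds_norm_sub 0).tendsto_right_iff]
  rintro ⟨K, δ⟩ ⟨-, hδ⟩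
  filter_upwards [Metric.ball_mem_nhds 0 hδ] with f hf x _
  rw [ContinuousMap.zero_apply, sub_zero]
  exact (f.norm_coe_le_norm x).trans_lt (by simpa using hf)

/-- If `X` is completely regular and its relatively pseudocompact subsets are relatively compact,
then `C(X, ℂ)` is barrelled. -/
theorem ContinuousMap.barrelledSpace {X : Type*} [TopologicalSpace X] [CompletelyRegularSpace X]
    (hX : ∀ S : Set X, IsRelPseudocompact S → IsRelCompact S) : BarrelledSpace ℂ C(X, ℂ) := by
  refine ⟨fun p hp => ?_⟩
  have hK : IsCompact p.functionSupport := by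
    have := hX _ (Seminorm.isRelPseudocompact_functionSupport hp)
    rwa [IsRelCompact, p.isClosed_functionSupport.closure_eq] at this
  let ι := BoundedContinuousFunction.toContinuousMapLinear X
  -- The bounded functions form a Banach space, hence a barrelled one.
  have hq : Continuous (p.comp ι) := (p.comp ι).continuous_of_lowerSemicontinuous
    (hp.comp (BoundedContinuousFunction.continuous_toContinuousMapLinear X))
  obtain ⟨C, hC0, hC⟩ := Seminorm.bound_of_continuous_normedSpace (p.comp ι) hq
  have hδ : 0 < C⁻¹ := inv_pos.2 hC0
  refine Seminorm.continuous' (r := 1) ?_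
  filter_upwards [ContinuousMap.setOf_norm_lt_mem_nhds_zero hK hδ] with f hf
  rw [Seminorm.mem_closedBall_zero]
  have hmax : ∀ x, 0 < max ‖f x‖ C⁻¹ := fun x => hδ.trans_le (le_max_right _ _)
  have hcont : Continuous fun x => C⁻¹ * (max ‖f x‖ C⁻¹)⁻¹ :=
    continuous_const.mul ((f.continuous.norm.max continuous_const).inv₀ fun x => (hmax x).ne')
  -- Radial truncation of `f` at height `C⁻¹`. It agrees with `f` on the support, where `|f| < C⁻¹`.
  let k : BoundedContinuousFunction X ℂ := BoundedContinuousFunction.ofNormedAddCommGroup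
    (fun x => ((C⁻¹ * (max ‖f x‖ C⁻¹)⁻¹ : ℝ) : ℂ) * f x) (by fun_prop) C⁻¹ fun x => by
      rw [norm_mul, Complex.norm_of_nonneg (mul_pos hδ (inv_pos.2 (hmax x))).le, mul_assoc]
      refine mul_le_of_le_one_right hδ.le ?_
      rw [inv_mul_le_one₀ (hmax x)]
      exact le_max_left _ _
  have hk : ‖k‖ ≤ C⁻¹ := BoundedContinuousFunction.norm_ofNormedAddCommGroup_le _ hδ.le _
  have hfk : p (f - ι k) = 0 := by
    refine Seminorm.apply_eq_zero_of_forall_functionSupport hp fun x hx => ?_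
    have : ι k x = ((C⁻¹ * (max ‖f x‖ C⁻¹)⁻¹ : ℝ) : ℂ) * f x := rfl
    rw [ContinuousMap.sub_apply, this, max_eq_right (hf x hx).le, mul_inv_cancel₀ hδ.ne']
    simp
  calc p f = p ((f - ι k) + ι k) := by rw [sub_add_cancel]
    _ ≤ p (f - ι k) + p (ι k) := map_add_le_add p _ _
    _ ≤ C * C⁻¹ := by
      rw [hfk, zero_add]
      exact (hC k).trans (mul_le_mul_of_nonneg_left hk hC0.le)
    _ = 1 := mul_inv_cancel₀ hC0.ne'

/-- Being barrelled is invariant under linear homeomorphisms. -/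
theorem BarrelledSpace.of_linearEquiv {E F : Type*} [AddCommGroup E] [Module ℂ E]
    [TopologicalSpace E] [AddCommGroup F] [Module ℂ F] [TopologicalSpace F] [BarrelledSpace ℂ F]
    (e : E ≃L[ℂ] F) : BarrelledSpace ℂ E := by
  refine ⟨fun p hp => ?_⟩
  have h := (p.comp (e.symm : F →ₗ[ℂ] E)).continuous_of_lowerSemicontinuous
    (hp.comp e.symm.continuous)
  refine (h.comp e.continuous).congr fun x => ?_
  simp

/-! ### Compact subspaces of the Tychonoff reflection -/

namespace TychonoffReflection

variable {X : Type*} [TopologicalSpace X]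

theorem injective_unit [FunctionallyHausdorffSpace X] : Function.Injective (unit X) := by
  intro x y hxy
  by_contra hne
  obtain ⟨f, hf⟩ := FunctionallyHausdorffSpace.exists_ne x y hne
  exact hf (congrFun (congrArg Subtype.val hxy) f)

/-- Each `f` is the pullback of a coordinate function on the reflection. -/
theorem isRelPseudocompact_of_isCompact_image {K : Set X} (hK : IsCompact (unit X '' K)) :
    IsRelPseudocompact K := by
  intro f
  have h : Continuous fun t : TychonoffReflection X => t.1 f :=
    (continuous_apply f).comp continuous_subtype_val
  have := (hK.image h).isBounded
  rwa [Set.image_image] at this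

theorem isEmbedding_unit_restrict [FunctionallyHausdorffSpace X] {K : Set X} (hK : IsCompact K) :
    IsEmbedding fun x : K => unit X x := by
  have : CompactSpace K := isCompact_iff_compactSpace.1 hK
  exact (((continuous_unit X).comp continuous_subtype_val).isClosedEmbedding
    (injective_unit.comp Subtype.val_injective)).isEmbedding

theorem isCompact_image_unit_iff [FunctionallyHausdorffSpace X]
    (hX : ∀ S : Set X, IsRelPseudocompact S → IsRelCompact S) (K : Set X) :
    IsCompact (unit X '' K) ↔ IsCompact K := by
  refine ⟨fun h => ?_, fun h => h.image (continuous_unit X)⟩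
  have hM : IsCompact (closure K) := hX K (isRelPseudocompact_of_isCompact_image h)
  -- By injectivity `K` is the preimage of its compact, hence closed, image.
  have hclosed : IsClosed (unit X ⁻¹' (unit X '' K)) := h.isClosed.preimage (continuous_unit X)
  rw [injective_unit.preimage_image] at hclosed
  rwa [hclosed.closure_eq] at hM

end TychonoffReflection

theorem mainTheorem7 :
    (∀ (A : Type u) [CommRing A] [Algebra ℂ A] [StarRing A] [UniformSpace A]
        [IsProCStarAlgebra A],
      IsBarreled A ↔
        ∃ (X : Type u) (_ : TopologicalSpace X), T35Space X ∧
          (∀ S : Set X, IsRelPseudocompact S → IsRelCompact S) ∧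
          ∃ φ : A ≃⋆ₐ[ℂ] C(X, ℂ), IsHomeomorph φ) ∧
    (∀ (X : Type v) [TopologicalSpace X] [FunctionallyHausdorffSpace X]
        [CompactlyCoherentSpace X],
      (∀ S : Set X, IsRelPseudocompact S → IsRelCompact S) →
        Function.Bijective (TychonoffReflection.unit X) ∧
        (∀ K : Set X, IsCompact (TychonoffReflection.unit X '' K) ↔ IsCompact K) ∧
        (∀ K : Set X, IsCompact K → IsEmbedding fun x : K => TychonoffReflection.unit X x)) := by
  refine ⟨fun A _ _ _ _ _ => ⟨fun hA => ?_, ?_⟩, fun X _ _ _ hX => ?_⟩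
  · exact ⟨continuousCharacters A, inferInstance, inferInstance,
      hA.isRelCompact_of_isRelPseudocompact, _, hA.isHomeomorph_gelfandHom⟩
  · rintro ⟨X, _, _, hX, φ, hφ⟩
    have := ContinuousMap.barrelledSpace hX
    let e : A ≃L[ℂ] C(X, ℂ) :=
      { φ.toAlgEquiv.toLinearEquiv with
        continuous_toFun := hφ.continuous
        continuous_invFun := (hφ.homeomorph φ).symm.continuous.congr fun f =>
          (hφ.homeomorph φ).injective (((hφ.homeomorph φ).apply_symm_apply f).trans
            (φ.apply_symm_apply f).symm) }
    exact isBarreled_iff_barrelledSpace.2 (BarrelledSpace.of_linearEquiv e)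
  · exact ⟨⟨TychonoffReflection.injective_unit, TychonoffReflection.surjective_unit X⟩,
      TychonoffReflection.isCompact_image_unit_iff hX,
      fun _ => TychonoffReflection.isEmbedding_unit_restrict⟩
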